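/- **Setting.** Let $d\ge 1$, let $\mathcal O\subseteq\mathbb R^d$ be a non-empty Borel set, and let $N\ge 1$. Let $$Y_i=u_0(X_i)+\varepsilon_i,\qquad i=1,\dots,N,$$ where $u_0:\mathcal O\to\mathbb R$ is a regression function. The design points $X_i\in\mathcal O$ are random or deterministic. The noise variables $\varepsilon_i\sim N(0,\sigma_i^2)$ are independent of each other and of the design $X=(X_1,\dots,X_N)$, and $\sup_i\sigma_i\le\sigma$ with $\sigma>0$. Let $H,\Theta$ be sets, let $\eta\mapsto u_\eta$ map $H$ to real functions on $\mathcal O$, and let $\mathcal R:H\times\Theta\to[0,\infty)$. Put $\|h\|_N^2=\frac1N\sum_{i=1}^N h(X_i)^2$. Let $(\hat\eta,\hat\theta)$ be a function of the data $(Y_i,X_i)_{i\le N}$ that minimises $$J(\eta,\theta)=\frac1N\sum_{i=1}^N (Y_i-u_\eta(X_i))^2+\mathcal R(\eta,\theta)$$ over $H\times\Theta$. Define $$\tau^2((\eta,\theta),w)=\|u_\eta-w\|_N^2+\mathcal R(\eta,\theta).$$ It is assumed that $\tau^2((\hat\eta,\hat\theta),u_0)$ is a measurable function of the data, and that $u_0$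 and $u_{\eta^*}$ (for the $\eta^*$ below) are measurable. For $\eta^*\in H$ and $R>0$ let $$\mathcal U(\eta^*,R)=\{u_\eta:\ (\eta,\theta)\in H\times\Theta,\ \tau^2((\eta,\theta),u_{\eta^*})\le R^2\},$$ $$\mathcal I(\eta^*,R)=\sigma R+\int_0^{\sigma R}H^{1/2}\big(\rho,\mathcal U(\eta^*,R),\sigma\|\cdot\|_N\big)\,d\rho,$$ where $H(\rho,\mathcal U,\sigma\|\cdot\|_N)$ is the logarithm of the minimal number of closed $\sigma\|\cdot\|_N$-balls of radius $\rho$ (with arbitrary centres) covering $\mathcal U$, and the entropy of the empty set is $0$. **Theorem.** There are a universal constant $C>0$ and, for every real $k\ge1$, a constant $C_k>0$ depending only on $k$ such that the following holds in every setting as above. Let $(\eta^*,\theta^*)\in H\times\Theta$, and let $\Psi:(0,\infty)\to\mathbb R$ be such that $R\mapsto\Psi(R)/R^2$ is non-increasing and, almost surely, $\Psi(R)\ge\mathcal I(\eta^*,R)$ for all $R>0$. Let $\delta_N>0$ satisfy $\sqrt N\,\delta_N^2\ge C\,\Psi(\delta_N)$. Then, conditionally on the design, for all $R\ge\delta_N$,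 $$\mathbb P\Big(\tau^2((\hat\eta,\hat\theta),u_0)\ge 2\big(\tau^2((\eta^*,\theta^*),u_0)+R^2\big)\,\Big|\,X\Big)\le C\exp\Big(-\frac{NR^2}{C\sigma^2}\Big),$$ and for all real $k\ge1$, $$\mathbb E\big[\tau^{2k}((\hat\eta,\hat\theta),u_0)\,\big|\,X\big]\le C_k\Big(\tau^{2k}((\eta^*,\theta^*),u_0)+\delta_N^{2k}+\frac{\delta_N^{2k-2}\sigma^2}{N}\Big).$$ Here the conditional statements mean that, for every Borel set $B\subseteq\mathcal O^N$, the inequality holds after integrating both sides over the event $\{X\in B\}$. The choice $B=\mathcal O^N$ gives the unconditional bounds. -/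

import Mathlib

open MeasureTheory ProbabilityTheory
open scoped NNReal ENNReal

namespace AugmentedMEstimation

noncomputable section

/-- The squared empirical norm `‖h‖_N² = N⁻¹ ∑ᵢ h(xᵢ)²` of a function on the design space. -/
def empNormSq {S : Type*} {N : ℕ} (x : Fin N → S) (h : S → ℝ) : ℝ :=
  (1 / (N : ℝ)) * ∑ i, (h (x i)) ^ 2

/-- The empirical (semi)norm `‖h‖_N`. -/
def empNorm {S : Type*} {N : ℕ} (x : Fin N → S) (h : S → ℝ) : ℝ :=
  Real.sqrt (empNormSq x h)

/-- The penalised least squares objective `J(η, θ) = N⁻¹ ∑ᵢ (yᵢ - u_η(xᵢ))² + 𝓡(η, θ)`. -/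
def objective {S H T : Type*} {N : ℕ} (u : H → S → ℝ) (pen : H → T → ℝ)
    (x : Fin N → S) (y : Fin N → ℝ) (p : H × T) : ℝ :=
  (1 / (N : ℝ)) * ∑ i, (y i - u p.1 (x i)) ^ 2 + pen p.1 p.2

/-- The discrepancy functional `τ²((η, θ), w) = ‖u_η - w‖_N² + 𝓡(η, θ)`. -/
def tauSq {S H T : Type*} {N : ℕ} (u : H → S → ℝ) (pen : H → T → ℝ)
    (x : Fin N → S) (p : H × T) (w : S → ℝ) : ℝ :=
  empNormSq x (u p.1 - w) + pen p.1 p.2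

/-- The localised class `𝓤(η*, R)` of all `u_η` with `τ²((η, θ), u_{η*}) ≤ R²` for some `θ`. -/
def localClass {S H T : Type*} {N : ℕ} (u : H → S → ℝ) (pen : H → T → ℝ)
    (x : Fin N → S) (etaStar : H) (R : ℝ) : Set (S → ℝ) :=
  {w | ∃ (η : H) (θ : T), w = u η ∧ tauSq u pen x (η, θ) (u etaStar) ≤ R ^ 2}

/-- The pseudometric `(v, w) ↦ σ ‖v - w‖_N` on functions `S → ℝ` (see `empDist_eq`), obtained by
pulling back the Euclidean metric along `w ↦ (σ N^{-1/2} w(xᵢ))ᵢ`. -/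
@[reducible]
def empPseudoMetric {S : Type*} {N : ℕ} (x : Fin N → S) (σ : ℝ) : PseudoMetricSpace (S → ℝ) :=
  PseudoMetricSpace.induced
    (fun w => (WithLp.toLp 2 (fun i => σ / Real.sqrt N * w (x i)) : EuclideanSpace ℝ (Fin N)))
    inferInstance

theorem empDist_eq {S : Type*} {N : ℕ} (x : Fin N → S) {σ : ℝ} (hσ : 0 ≤ σ) (v w : S → ℝ) :
    (empPseudoMetric x σ).dist v w = σ * empNorm x (v - w) := by
  change dist (WithLp.toLp 2 (fun i => σ / Real.sqrt N * v (x i)) : EuclideanSpace ℝ (Fin N))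
    (WithLp.toLp 2 (fun i => σ / Real.sqrt N * w (x i))) = _
  rw [EuclideanSpace.dist_eq, empNorm, empNormSq]
  have h1 : ∀ i, dist (σ / Real.sqrt N * v (x i)) (σ / Real.sqrt N * w (x i)) ^ 2
      = σ ^ 2 * ((1 / (N : ℝ)) * ((v - w) (x i)) ^ 2) := by
    intro i
    rw [Real.dist_eq, sq_abs, ← mul_sub, mul_pow, div_pow, Real.sq_sqrt (Nat.cast_nonneg N),
      Pi.sub_apply]
    ring
  simp only [h1]
  rw [← Finset.mul_sum, ← Finset.mul_sum, Real.sqrt_mul (sq_nonneg σ), Real.sqrt_sq hσ]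

/-- The metric entropy `H(ρ, A, σ‖·‖_N)`: the logarithm of the minimal number of closed
`σ‖·‖_N`-balls of radius `ρ` (with arbitrary centres) needed to cover `A`. The value is in
`[0, ∞]`; the empty set has entropy `0`. -/
def empEntropy {S : Type*} {N : ℕ} (x : Fin N → S) (σ : ℝ) (ρ : ℝ≥0) (A : Set (S → ℝ)) : ℝ≥0∞ :=
  letI := empPseudoMetric x σ
  (ENNReal.log ((Metric.externalCoveringNumber ρ A : ℕ∞) : ℝ≥0∞)).toENNReal

/-- The entropy integral
`𝓘(η*, R) = σR + ∫₀^{σR} H^{1/2}(ρ, 𝓤(η*, R), σ‖·‖_N) dρ`, with values in `[0, ∞]`. -/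
def entropyIntegral {S H T : Type*} {N : ℕ} (u : H → S → ℝ) (pen : H → T → ℝ)
    (x : Fin N → S) (σ : ℝ) (etaStar : H) (R : ℝ) : ℝ≥0∞ :=
  ENNReal.ofReal (σ * R) +
    ∫⁻ ρ in Set.Ioc (0 : ℝ) (σ * R),
      (empEntropy x σ ρ.toNNReal (localClass u pen x etaStar R)) ^ (1 / 2 : ℝ)

end

end AugmentedMEstimation

open AugmentedMEstimation

open AugmentedMEstimation

/-! Minimality of the estimator p̂ against p* = (η*, θ*) gives the basic inequality τ²(p̂, u₀) ≤
τ²(p*, u₀) + 2 N⁻¹ ∑ εᵢ (u_η̂ - u_η*)(Xᵢ), which is `tauSq_le_of_objective_le`. If τ²(p̂, u₀) ≥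
2(τ²(p*, u₀) + R²), the noise average therefore exceeds a fixed fraction of W = τ²(p̂, u_η*), plus a
multiple of R².

The event is peeled according to the first dyadic radius 2^j R with W ≤ (2^j R)². For fixed design
the noise average, times √N, is a process with sub-Gaussian increments in σ‖·‖_N, so Dudley's bound
(`measure_exists_gt_le_of_entropyIntegral`) controls its supremum over the local class by the
entropy integral, up to a Gaussian deviation. Monotonicity of Ψ(R)/R² carries the condition at δ_N
to every larger radius, and level j costs exp(-4^j N R²/(Cσ²)). These costs sum to a multiple of the
first one, because the summand σR of the entropy integral already forces N δ_N² ≥ Cσ².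

Independence of noise and design turns the fixed-design bound into the conditional one by Fubini
(`measure_inter_le_of_indepFun`). The moment bound sums the tails over the radii 2^j δ_N
(`lintegral_rpow_le_of_tail`). -/

/-! ### Generic chaining over finite nets -/

/-- Chaining along finite nets `C j` of radius `D / 2 ^ j`: a tail bound for the supremum of a
process with sub-Gaussian increments. -/
theorem measure_exists_gt_le_of_nets {E Ω : Type*} [PseudoMetricSpace E] [MeasurableSpace Ω]
    {μ : Measure Ω} {Z : E → Ω → ℝ}
    (hsub : ∀ a b r t, 0 < r → 0 ≤ t → dist a b ≤ r →
      μ {ω | t ≤ Z a ω - Z b ω} ≤ ENNReal.ofReal (Real.exp (-(t ^ 2 / (2 * r ^ 2)))))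
    (hcont : ∀ ω, Continuous fun a => Z a ω)
    {A : Set E} {c : E} {D S x : ℝ} (hD : 0 < D) (hx : 0 ≤ x) {C : ℕ → Finset E}
    (hC0 : C 0 = {c}) (hcard : ∀ j, (C j).card ≤ (C (j + 1)).card)
    (hcov : ∀ j, ∀ a ∈ A, ∃ b ∈ C j, dist a b ≤ D / 2 ^ j)
    (hS : ∀ n, ∑ j ∈ Finset.range n,
      D / 2 ^ (j + 1) * Real.sqrt (Real.log (C (j + 1)).card) ≤ S) :
    μ {ω | ∃ a ∈ A, 6 * S + (9 + 5 * x) * D < Z a ω - Z c ω} ≤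
      ENNReal.ofReal (Real.exp (-x ^ 2)) := by
  classical
  set L : ℕ → ℝ := fun j => Real.log (C (j + 1)).card with hL
  -- A link joins approximants at levels j and j + 1, so its length is at most D/2^j + D/2^(j+1) =
  -- `r j`. The threshold `t j` makes the exponent at least 2 L_j + (j + 1) + x²: the first term
  -- pays for the pairs of net points, the second for the union over levels, and x² is what remains.
  set r : ℕ → ℝ := fun j => 3 * (D / 2 ^ (j + 1)) with hr
  set t : ℕ → ℝ := fun j => r j * Real.sqrt 2 * (Real.sqrt (2 * L j) + (j + 1) + x) with ht
  have hcpos : ∀ j, 1 ≤ (C j).card := by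
    intro j
    induction j with
    | zero => simp [hC0]
    | succ j ih => exact ih.trans (hcard j)
  have hL0 : ∀ j, 0 ≤ L j := fun j => Real.log_natCast_nonneg _
  have hrpos : ∀ j, 0 < r j := fun j => by positivity
  have ht0 : ∀ j, 0 ≤ t j := fun j => by positivity
  have h2 : Real.sqrt 2 ^ 2 = 2 := Real.sq_sqrt (by norm_num)
  have hs2 : Real.sqrt 2 ≤ 3 / 2 := by
    rw [Real.sqrt_le_left (by norm_num)]; norm_num
  have hexp : ∀ j, 2 * L j + (j + 1) + x ^ 2 ≤ t j ^ 2 / (2 * r j ^ 2) := by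
    intro j
    have h1 : t j ^ 2 / (2 * r j ^ 2) = (Real.sqrt (2 * L j) + (j + 1) + x) ^ 2 := by
      simp only [ht]
      rw [mul_pow, mul_pow, h2]
      have := (hrpos j).ne'
      field_simp
    rw [h1]
    have h3 : Real.sqrt (2 * L j) ^ 2 = 2 * L j := Real.sq_sqrt (by linarith [hL0 j])
    have h4 : 0 ≤ Real.sqrt (2 * L j) := Real.sqrt_nonneg _
    have h5 : (0 : ℝ) ≤ j := Nat.cast_nonneg j
    nlinarith [mul_nonneg h4 h5, mul_nonneg h4 hx, mul_nonneg h5 hx, mul_nonneg h5 h5]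
  have hsum : ∀ n, ∑ j ∈ Finset.range n, t j ≤ 6 * S + (9 + 5 * x) * D := by
    intro n
    have hgeo : ∀ n : ℕ, ∑ j ∈ Finset.range n, ((1 : ℝ) / 2 ^ (j + 1)) = 1 - 1 / 2 ^ n := by
      intro n
      induction n with
      | zero => simp
      | succ n ih => rw [Finset.sum_range_succ, ih, pow_succ]; field_simp; ring
    have hgeo2 : ∀ n : ℕ, ∑ j ∈ Finset.range n, (((j : ℝ) + 1) / 2 ^ (j + 1)) =
        2 - (n + 2) / 2 ^ n := by
      intro n
      induction n with
      | zero => simp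
      | succ n ih => rw [Finset.sum_range_succ, ih, pow_succ]; push_cast; field_simp; ring
    have h1 : ∀ j, t j = 6 * (D / 2 ^ (j + 1) * Real.sqrt (L j)) +
        3 * Real.sqrt 2 * D * (((j : ℝ) + 1) / 2 ^ (j + 1)) +
        3 * Real.sqrt 2 * D * x * (1 / 2 ^ (j + 1)) := by
      intro j
      simp only [ht, hr]
      rw [Real.sqrt_mul (by norm_num)]
      linear_combination (3 * (D / 2 ^ (j + 1)) * Real.sqrt (L j)) * h2
    simp only [h1]
    rw [Finset.sum_add_distrib, Finset.sum_add_distrib, ← Finset.mul_sum, ← Finset.mul_sum,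
      ← Finset.mul_sum, hgeo, hgeo2]
    have h5 : 3 * Real.sqrt 2 * D * (2 - (n + 2) / 2 ^ n) ≤ 3 * (3 / 2) * D * 2 := by
      have : (0 : ℝ) ≤ (n + 2) / 2 ^ n := by positivity
      have h6 : 3 * Real.sqrt 2 * D ≤ 3 * (3 / 2) * D := by gcongr
      have h7 : 0 ≤ 3 * Real.sqrt 2 * D := by positivity
      nlinarith [mul_nonneg h7 this]
    have h6 : 3 * Real.sqrt 2 * D * x * (1 - 1 / 2 ^ n) ≤ 3 * (3 / 2) * D * x := by
      have : (0 : ℝ) ≤ 1 / 2 ^ n := by positivity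
      have h6 : 3 * Real.sqrt 2 * D * x ≤ 3 * (3 / 2) * D * x := by gcongr
      have h7 : 0 ≤ 3 * Real.sqrt 2 * D * x := by positivity
      nlinarith [mul_nonneg h7 this]
    have h7 := hS n
    have h8 : 0 ≤ D * x := by positivity
    nlinarith
  -- Only short links between net points enter, so each level is a finite union. Outside all of
  -- them, every chain is controlled simultaneously.
  set bad : ℕ → Set Ω := fun j => ⋃ p ∈ (C j ×ˢ C (j + 1)).filter (fun p => dist p.2 p.1 ≤ r j),
    {ω | t j ≤ Z p.2 ω - Z p.1 ω} with hbad
  have hbadm : ∀ j, μ (bad j) ≤ ENNReal.ofReal (Real.exp (-x ^ 2)) * 2⁻¹ ^ (j + 1) := by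
    intro j
    refine (measure_biUnion_finset_le _ _).trans ?_
    refine (Finset.sum_le_card_nsmul _ _
      (ENNReal.ofReal (Real.exp (-(t j ^ 2 / (2 * r j ^ 2))))) ?_).trans ?_
    · intro p hp
      exact hsub _ _ _ _ (hrpos j) (ht0 j) (Finset.mem_filter.1 hp).2
    · have hn : (((C j ×ˢ C (j + 1)).filter (fun p => dist p.2 p.1 ≤ r j)).card : ℝ) ≤
          Real.exp (2 * L j) := by
        have h1 : ((C j ×ˢ C (j + 1)).filter (fun p => dist p.2 p.1 ≤ r j)).card ≤
            (C (j + 1)).card * (C (j + 1)).card := by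
          refine (Finset.card_filter_le _ _).trans ?_
          rw [Finset.card_product]
          exact Nat.mul_le_mul_right _ (hcard j)
        have h3 : Real.exp (2 * L j) = ((C (j + 1)).card : ℝ) * (C (j + 1)).card := by
          rw [two_mul, Real.exp_add, hL,
            Real.exp_log (by exact_mod_cast hcpos (j + 1))]
        rw [h3]
        exact_mod_cast h1
      have h2' : (2⁻¹ : ℝ≥0∞) ^ (j + 1) = ENNReal.ofReal ((1 / 2) ^ (j + 1)) := by
        rw [ENNReal.ofReal_pow (by norm_num), one_div, ENNReal.ofReal_inv_of_pos (by norm_num)]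
        simp
      rw [nsmul_eq_mul, h2', ← ENNReal.ofReal_mul (Real.exp_nonneg _), ← ENNReal.ofReal_natCast,
        ← ENNReal.ofReal_mul (Nat.cast_nonneg _)]
      apply ENNReal.ofReal_le_ofReal
      have h4 : Real.exp (-1) ≤ 1 / 2 := by
        rw [Real.exp_neg, one_div]
        apply inv_anti₀ (by norm_num)
        linarith [Real.add_one_le_exp 1]
      calc _ ≤ Real.exp (2 * L j) * Real.exp (-(t j ^ 2 / (2 * r j ^ 2))) := by gcongr
        _ ≤ Real.exp (2 * L j) * Real.exp (-(2 * L j + (j + 1) + x ^ 2)) := by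
          gcongr
          exact hexp j
        _ = Real.exp (-x ^ 2) * Real.exp (-1) ^ (j + 1) := by
          rw [← Real.exp_add, ← Real.exp_nat_mul, ← Real.exp_add]
          congr 1
          push_cast
          ring
        _ ≤ _ := by gcongr
  refine (measure_mono (t := ⋃ j, bad j) ?_).trans ((measure_iUnion_le _).trans
    ((ENNReal.tsum_le_tsum hbadm).trans ?_))
  · rintro ω ⟨a, haA, ha⟩
    by_contra hω
    simp only [hbad, Set.mem_iUnion, not_exists, Set.mem_ofPred_eq, not_le, Finset.mem_filter,
      Finset.mem_product, and_imp, Prod.forall] at hω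
    choose π hπ hπd using fun j => hcov j a haA
    have hstep : ∀ n, Z (π n) ω - Z c ω ≤ ∑ j ∈ Finset.range n, t j := by
      intro n
      induction n with
      | zero =>
        have : π 0 = c := by simpa [hC0] using hπ 0
        simp [this]
      | succ n ih =>
        rw [Finset.sum_range_succ]
        have h1 : dist (π (n + 1)) (π n) ≤ r n := by
          have h2 := dist_triangle_left (π (n + 1)) (π n) a
          have h3 := hπd n
          have h4 := hπd (n + 1)
          have h5 : D / 2 ^ n = 2 * (D / 2 ^ (n + 1)) := by rw [pow_succ]; field_simp
          simp only [hr]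
          linarith
        have := hω n (π n) (π (n + 1)) (hπ n) (hπ (n + 1)) h1
        linarith
    -- Continuity of the paths passes the telescoped bound from the net points to `a`, so `A` may be
    -- uncountable and the event need not be measurable.
    have hlim : Filter.Tendsto π Filter.atTop (nhds a) := by
      rw [tendsto_iff_dist_tendsto_zero]
      refine squeeze_zero (g := fun n => D / 2 ^ n) (fun _ => dist_nonneg)
        (fun n => (dist_comm _ _).trans_le (hπd n)) ?_
      have := (tendsto_pow_atTop_nhds_zero_of_lt_one (r := (1 / 2 : ℝ)) (by norm_num)
        (by norm_num)).const_mul D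
      simpa [div_eq_mul_inv] using this
    have hlim2 := (((hcont ω).tendsto a).comp hlim).sub_const (Z c ω)
    have := le_of_tendsto' hlim2 fun n => (hstep n).trans (hsum n)
    linarith
  · rw [ENNReal.tsum_mul_left, ENNReal.tsum_geometric_add_one]
    rw [ENNReal.one_sub_inv_two, inv_inv, ENNReal.inv_mul_cancel (by simp) (by simp), mul_one]

/-! ### Metric entropy and Dudley's bound -/

/-- A minimal finite external net for a set of finite entropy. -/
theorem exists_finset_net {E : Type*} [PseudoMetricSpace E] {A : Set E} {ρ : ℝ≥0}
    (h : Metric.externalCoveringNumber ρ A ≠ ⊤) :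
    ∃ C : Finset E, (∀ a ∈ A, ∃ b ∈ C, dist a b ≤ ρ) ∧
      (C.card : ℕ∞) = Metric.externalCoveringNumber ρ A := by
  obtain ⟨C, hC⟩ : ∃ C : {C : Set E // Metric.IsCover ρ A C},
      C.1.encard = ⨅ C : {C : Set E // Metric.IsCover ρ A C}, C.1.encard := by
    have : Nonempty {C : Set E // Metric.IsCover ρ A C} := by
      by_contra hne
      rw [not_nonempty_iff] at hne
      apply h
      rw [Metric.externalCoveringNumber, iInf_subtype', iInf_of_empty]
    exact ENat.exists_eq_iInf _
  have hC' : C.1.encard = Metric.externalCoveringNumber ρ A := by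
    rw [hC, Metric.externalCoveringNumber, iInf_subtype']
  have hfin : C.1.Finite := by
    rw [← Set.encard_ne_top_iff, hC']
    exact h
  refine ⟨hfin.toFinset, fun a ha => ?_, ?_⟩
  · obtain ⟨b, hb, hab⟩ := C.2 ha
    refine ⟨b, hfin.mem_toFinset.2 hb, ?_⟩
    have : edist a b ≤ ρ := hab
    rwa [edist_nndist, ENNReal.coe_le_coe, ← NNReal.coe_le_coe, coe_nndist] at this
  · rw [← hC', hfin.encard_eq_coe_toFinset_card]

/-- The square root of the metric entropy of `A` at radius `ρ`. -/
noncomputable def sqrtEntropy {E : Type*} [PseudoMetricSpace E] (A : Set E) (ρ : ℝ) : ℝ≥0∞ :=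
  (ENNReal.log ((Metric.externalCoveringNumber ρ.toNNReal A : ℕ∞) : ℝ≥0∞)).toENNReal ^ (1 / 2 : ℝ)

theorem sqrtEntropy_antitone {E : Type*} [PseudoMetricSpace E] (A : Set E) :
    Antitone (sqrtEntropy A) := by
  intro a b hab
  unfold sqrtEntropy
  refine ENNReal.rpow_le_rpow (EReal.toENNReal_le_toENNReal (ENNReal.log_le_log ?_)) (by norm_num)
  exact_mod_cast Metric.externalCoveringNumber_anti (Real.toNNReal_le_toNNReal hab)

theorem externalCoveringNumber_ne_top_of_sqrtEntropy {E : Type*} [PseudoMetricSpace E] {A : Set E}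
    {ρ : ℝ} (h : sqrtEntropy A ρ ≠ ⊤) : Metric.externalCoveringNumber ρ.toNNReal A ≠ ⊤ := by
  intro h'
  apply h
  simp [sqrtEntropy, h']

theorem sqrtEntropy_eq {E : Type*} [PseudoMetricSpace E] {A : Set E} {ρ : ℝ} {n : ℕ} (hn : 1 ≤ n)
    (h : (n : ℕ∞) = Metric.externalCoveringNumber ρ.toNNReal A) :
    sqrtEntropy A ρ = ENNReal.ofReal (Real.sqrt (Real.log n)) := by
  have h1 : (((n : ℕ∞) : ℝ≥0∞)) = ENNReal.ofReal n := by simp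
  rw [sqrtEntropy, ← h, h1, ENNReal.log_ofReal_of_pos (by exact_mod_cast hn),
    EReal.toENNReal_of_ne_top (by simp), EReal.toReal_coe, Real.sqrt_eq_rpow,
    ENNReal.ofReal_rpow_of_nonneg (Real.log_natCast_nonneg n) (by norm_num)]

/-- Dyadic sums of the square root entropy are bounded by the entropy integral. -/
theorem sum_mul_sqrtEntropy_le {E : Type*} [PseudoMetricSpace E] (A : Set E) {D : ℝ} (hD : 0 < D)
    (n : ℕ) :
    ∑ j ∈ Finset.range n, ENNReal.ofReal (D / 2 ^ (j + 1)) * sqrtEntropy A (D / 2 ^ (j + 1)) ≤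
      2 * ∫⁻ ρ in Set.Ioc 0 D, sqrtEntropy A ρ := by
  have key : ∀ n, ∑ j ∈ Finset.range n,
      ENNReal.ofReal (D / 2 ^ (j + 1)) * sqrtEntropy A (D / 2 ^ (j + 1)) ≤
      2 * ∫⁻ ρ in Set.Ioc (D / 2 ^ (n + 1)) D, sqrtEntropy A ρ := by
    intro n
    induction n with
    | zero => simp
    | succ n ih =>
      have hlt : D / 2 ^ (n + 1 + 1) ≤ D / 2 ^ (n + 1) := by
        gcongr
        · norm_num
        · omega
      have hle : D / 2 ^ (n + 1) ≤ D := div_le_self hD.le (one_le_pow₀ (by norm_num))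
      rw [Finset.sum_range_succ, ← Set.Ioc_union_Ioc_eq_Ioc hlt hle,
        lintegral_union measurableSet_Ioc (Set.Ioc_disjoint_Ioc_of_le le_rfl), mul_add, add_comm]
      refine add_le_add ?_ ih
      -- On (D/2^(n+2), D/2^(n+1)] the entropy is at least its value at the right endpoint. The
      -- interval is half as long as the weight D/2^(n+1), whence the factor 2.
      have h1 : ENNReal.ofReal (D / 2 ^ (n + 1 + 1)) * sqrtEntropy A (D / 2 ^ (n + 1)) ≤
          ∫⁻ ρ in Set.Ioc (D / 2 ^ (n + 1 + 1)) (D / 2 ^ (n + 1)), sqrtEntropy A ρ := by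
        have : ENNReal.ofReal (D / 2 ^ (n + 1 + 1)) =
            volume (Set.Ioc (D / 2 ^ (n + 1 + 1)) (D / 2 ^ (n + 1))) := by
          rw [Real.volume_Ioc]
          congr 1
          rw [pow_succ 2 (n + 1)]
          field_simp
          norm_num
        rw [this, mul_comm, ← setLIntegral_const]
        exact setLIntegral_mono' measurableSet_Ioc fun ρ hρ => sqrtEntropy_antitone A hρ.2
      calc _ = 2 * (ENNReal.ofReal (D / 2 ^ (n + 1 + 1)) * sqrtEntropy A (D / 2 ^ (n + 1))) := by
            rw [← mul_assoc]
            congr 1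
            rw [show (2 : ℝ≥0∞) = ENNReal.ofReal 2 by simp, ← ENNReal.ofReal_mul (by norm_num)]
            congr 1
            rw [pow_succ 2 (n + 1)]
            field_simp
        _ ≤ _ := by gcongr
  refine (key n).trans ?_
  gcongr
  positivity

/-- **Dudley's entropy bound**, tail version. -/
theorem measure_exists_gt_le_of_entropyIntegral {E Ω : Type*} [PseudoMetricSpace E]
    [MeasurableSpace Ω] {μ : Measure Ω} {Z : E → Ω → ℝ}
    (hsub : ∀ a b r t, 0 < r → 0 ≤ t → dist a b ≤ r →
      μ {ω | t ≤ Z a ω - Z b ω} ≤ ENNReal.ofReal (Real.exp (-(t ^ 2 / (2 * r ^ 2)))))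
    (hcont : ∀ ω, Continuous fun a => Z a ω)
    {A : Set E} {c : E} {D I x : ℝ} (hD : 0 < D) (hx : 0 ≤ x) (hA : ∀ a ∈ A, dist a c ≤ D)
    (hI0 : 0 ≤ I)
    (hI : ENNReal.ofReal D + ∫⁻ ρ in Set.Ioc 0 D, sqrtEntropy A ρ ≤ ENNReal.ofReal I) :
    μ {ω | ∃ a ∈ A, 12 * I + 5 * x * D < Z a ω - Z c ω} ≤ ENNReal.ofReal (Real.exp (-x ^ 2)) := by
  classical
  rcases A.eq_empty_or_nonempty with rfl | hne
  · simp
  set J := ∫⁻ ρ in Set.Ioc 0 D, sqrtEntropy A ρ with hJ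
  have hJtop : J ≠ ⊤ := by
    refine ne_top_of_le_ne_top (ENNReal.ofReal_ne_top (r := I)) (le_trans le_add_self hI)
  have hDI : D + J.toReal ≤ I := by
    have := ENNReal.toReal_mono ENNReal.ofReal_ne_top hI
    rwa [ENNReal.toReal_add ENNReal.ofReal_ne_top hJtop, ENNReal.toReal_ofReal hD.le,
      ENNReal.toReal_ofReal hI0] at this
  have hEtop : ∀ j : ℕ, sqrtEntropy A (D / 2 ^ (j + 1)) ≠ ⊤ := by
    intro j htop
    have h1 := (Finset.single_le_sum (f := fun i : ℕ => ENNReal.ofReal (D / 2 ^ (i + 1)) *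
      sqrtEntropy A (D / 2 ^ (i + 1))) (fun i _ => zero_le) (Finset.self_mem_range_succ j)).trans
      (sum_mul_sqrtEntropy_le A hD (j + 1))
    have hpos : ENNReal.ofReal (D / 2 ^ (j + 1)) ≠ 0 := by
      simp only [ne_eq, ENNReal.ofReal_eq_zero, not_le]; positivity
    rw [htop, ENNReal.mul_top hpos] at h1
    exact (ENNReal.mul_ne_top (by simp) hJtop) (top_le_iff.1 h1)
  choose C hCcov hCcard using fun j =>
    exists_finset_net (externalCoveringNumber_ne_top_of_sqrtEntropy (hEtop j))
  have hCpos : ∀ j, 1 ≤ (C j).card := by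
    intro j
    obtain ⟨a, ha⟩ := hne
    obtain ⟨b, hb, -⟩ := hCcov j a ha
    exact Finset.card_pos.2 ⟨b, hb⟩
  -- The nets `C j` have radius D/2^(j+1), so they are shifted by one level and the singleton {c} is
  -- put at level 0. Then 6 · 2J + 9D ≤ 12(D + J) ≤ 12 I.
  refine (measure_mono ?_).trans (measure_exists_gt_le_of_nets hsub hcont (A := A) (c := c)
    (S := 2 * J.toReal) hD hx (C := fun j => Nat.casesOn j {c} C) rfl ?_ ?_ ?_)
  · rintro ω ⟨a, ha, h⟩
    refine ⟨a, ha, lt_of_le_of_lt ?_ h⟩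
    nlinarith
  · rintro (_ | j)
    · simpa using hCpos 0
    · have h1 : ((C j).card : ℕ∞) ≤ (C (j + 1)).card := by
        rw [hCcard, hCcard]
        apply Metric.externalCoveringNumber_anti
        apply Real.toNNReal_le_toNNReal
        gcongr
        · norm_num
        · omega
      exact_mod_cast h1
  · rintro (_ | j) a ha
    · exact ⟨c, by simp, by simpa using hA a ha⟩
    · obtain ⟨b, hb, hab⟩ := hCcov j a ha
      refine ⟨b, hb, ?_⟩
      rwa [Real.coe_toNNReal _ (by positivity)] at hab
  · intro n
    have h1 := ENNReal.toReal_mono (ENNReal.mul_ne_top (by simp) hJtop)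
      (sum_mul_sqrtEntropy_le A hD n)
    rw [ENNReal.toReal_sum fun j _ => ENNReal.mul_ne_top (by simp) (hEtop j),
      ENNReal.toReal_mul] at h1
    refine le_trans (le_of_eq (Finset.sum_congr rfl fun j _ => ?_)) h1
    rw [ENNReal.toReal_mul, ENNReal.toReal_ofReal (by positivity),
      sqrtEntropy_eq (hCpos j) (hCcard j), ENNReal.toReal_ofReal (Real.sqrt_nonneg _)]

/-! ### Fixed design: noise on local classes, basic inequality and peeling -/

theorem empNormSq_nonneg {S : Type*} {N : ℕ} (x : Fin N → S) (h : S → ℝ) : 0 ≤ empNormSq x h := by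
  unfold empNormSq; positivity

theorem tauSq_nonneg {S H T : Type*} {N : ℕ} {u : H → S → ℝ} {pen : H → T → ℝ}
    (hpen : ∀ η θ, 0 ≤ pen η θ) (x : Fin N → S) (p : H × T) (w : S → ℝ) :
    0 ≤ tauSq u pen x p w :=
  add_nonneg (empNormSq_nonneg x _) (hpen _ _)

/-- Tail bound for the noise process over one localised class. -/
theorem measure_exists_localClass_le {S H T : Type*} {N : ℕ} (hN : 1 ≤ N) {u : H → S → ℝ}
    {pen : H → T → ℝ} (hpen : ∀ η θ, 0 ≤ pen η θ) {σ : ℝ} (hσ : 0 < σ)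
    {ν : Measure (Fin N → ℝ)}
    (hν : ∀ (a : Fin N → ℝ) (v t : ℝ), 0 < v → 0 ≤ t → σ ^ 2 * ∑ i, a i ^ 2 ≤ v →
      ν {e | t ≤ ∑ i, a i * e i} ≤ ENNReal.ofReal (Real.exp (-(t ^ 2 / (2 * v)))))
    (x : Fin N → S) (etaStar : H) {R I : ℝ} (hR : 0 < R)
    (hI : entropyIntegral u pen x σ etaStar R ≤ ENNReal.ofReal I)
    (hIR : 230400 * I ≤ Real.sqrt N * R ^ 2) :
    ν {e | ∃ f ∈ localClass u pen x etaStar R,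
        R ^ 2 / 48 ≤ 1 / (N : ℝ) * ∑ i, e i * (f - u etaStar) (x i)} ≤
      ENNReal.ofReal (Real.exp (-((N : ℝ) * R ^ 2 / (230400 * σ ^ 2)))) := by
  let := empPseudoMetric x σ
  have hN0 : (0 : ℝ) < N := by exact_mod_cast hN
  have hsN : 0 < Real.sqrt N := Real.sqrt_pos.2 hN0
  have hsN2 : Real.sqrt N ^ 2 = N := Real.sq_sqrt hN0.le
  have hI0 : 0 ≤ I := by
    by_contra hneg
    rw [ENNReal.ofReal_of_nonpos (not_le.1 hneg).le, entropyIntegral, nonpos_iff_eq_zero,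
      add_eq_zero, ENNReal.ofReal_eq_zero] at hI
    have : 0 < σ * R := by positivity
    linarith [hI.1]
  -- With the factor N^(-1/2), the variance bound for an increment is exactly the squared distance
  -- in σ‖·‖_N.
  set Z : (S → ℝ) → (Fin N → ℝ) → ℝ := fun f e => ∑ i, (f (x i) / Real.sqrt N) * e i with hZ
  have hZsub : ∀ f g e, Z f e - Z g e = ∑ i, ((f - g) (x i) / Real.sqrt N) * e i := by
    intro f g e
    simp only [hZ, ← Finset.sum_sub_distrib, Pi.sub_apply]
    exact Finset.sum_congr rfl fun i _ => by ring
  have hsub : ∀ (a b : S → ℝ) (r t : ℝ), 0 < r → 0 ≤ t → dist a b ≤ r →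
      ν {e | t ≤ Z a e - Z b e} ≤ ENNReal.ofReal (Real.exp (-(t ^ 2 / (2 * r ^ 2)))) := by
    intro a b r t hr ht hab
    simp only [hZsub]
    refine hν _ _ _ (by positivity) ht ?_
    rw [empDist_eq x hσ.le, empNorm] at hab
    have h1 : (σ * Real.sqrt (empNormSq x (a - b))) ^ 2 ≤ r ^ 2 :=
      pow_le_pow_left₀ (by positivity) hab 2
    rw [mul_pow, Real.sq_sqrt (empNormSq_nonneg x _), empNormSq] at h1
    simp only [div_pow, hsN2, ← Finset.sum_div]
    convert h1 using 2
    ring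
  have hcont : ∀ e, @Continuous (S → ℝ) ℝ
      (empPseudoMetric x σ).toUniformSpace.toTopologicalSpace _ fun f => Z f e := by
    intro e
    have h1 : (fun f => Z f e) = (fun w : EuclideanSpace ℝ (Fin N) => ∑ i, (w i / σ) * e i) ∘
        (fun f : S → ℝ => (WithLp.toLp 2 (fun i => σ / Real.sqrt N * f (x i)) :
          EuclideanSpace ℝ (Fin N))) := by
      funext f
      simp only [hZ, Function.comp]
      refine Finset.sum_congr rfl fun i _ => ?_
      field_simp
    rw [h1]
    exact @Continuous.comp _ _ _ (empPseudoMetric x σ).toUniformSpace.toTopologicalSpace _ _ _ _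
      (by fun_prop) continuous_induced_dom
  have hA : ∀ f ∈ localClass u pen x etaStar R, dist f (u etaStar) ≤ σ * R := by
    rintro _ ⟨η, θ, rfl, h⟩
    rw [empDist_eq x hσ.le, empNorm]
    gcongr
    rw [Real.sqrt_le_left hR.le]
    unfold tauSq at h
    linarith [hpen η θ]
  have hD : 0 < σ * R := by positivity
  set t : ℝ := Real.sqrt N * R ^ 2 / 48 with ht
  have ht0 : 0 < t := by positivity
  -- This x makes the deviation term 5xD equal to t/2, and `hIR` keeps 12 I below t/2. Since t = √N
  -- R²/48, x = √N R/(480 σ), and 480² = 230400 is the constant of the theorem.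
  have hmain := measure_exists_gt_le_of_entropyIntegral hsub hcont hD
    (x := t / (10 * (σ * R))) (by positivity) hA hI0 hI
  refine (measure_mono ?_).trans (hmain.trans (le_of_eq ?_))
  · rintro e ⟨f, hf, h⟩
    refine ⟨f, hf, ?_⟩
    have h1 : t ≤ Z f e - Z (u etaStar) e := by
      rw [hZsub]
      have h2 : ∑ i, (f - u etaStar) (x i) / Real.sqrt N * e i =
          Real.sqrt N * (1 / (N : ℝ) * ∑ i, e i * (f - u etaStar) (x i)) := by
        rw [Finset.mul_sum, Finset.mul_sum]
        refine Finset.sum_congr rfl fun i _ => ?_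
        have : (N : ℝ) = Real.sqrt N * Real.sqrt N := (Real.mul_self_sqrt hN0.le).symm
        field_simp
        rw [hsN2]
        ring
      rw [h2, ht, mul_div_assoc]
      gcongr
    have h3 : 5 * (t / (10 * (σ * R))) * (σ * R) = t / 2 := by field_simp; norm_num
    rw [h3]
    linarith
  · congr 2
    rw [ht]
    field_simp
    rw [hsN2]
    ring

/-- The basic inequality for a minimiser of the penalised least squares objective. -/
theorem tauSq_le_of_objective_le {S H T : Type*} {N : ℕ} {u : H → S → ℝ} {pen : H → T → ℝ}
    {x : Fin N → S} {u₀ : S → ℝ} {e : Fin N → ℝ} {p q : H × T}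
    (h : objective u pen x (fun i => u₀ (x i) + e i) p ≤
      objective u pen x (fun i => u₀ (x i) + e i) q) :
    tauSq u pen x p u₀ ≤ tauSq u pen x q u₀ +
      2 * (1 / (N : ℝ) * ∑ i, e i * (u p.1 - u q.1) (x i)) := by
  have key : ∀ p : H × T, objective u pen x (fun i => u₀ (x i) + e i) p =
      tauSq u pen x p u₀ - 2 * (1 / (N : ℝ) * ∑ i, e i * (u p.1 - u₀) (x i)) +
        1 / (N : ℝ) * ∑ i, e i ^ 2 := by
    intro p
    unfold objective tauSq empNormSq
    have : ∑ i, (u₀ (x i) + e i - u p.1 (x i)) ^ 2 = ∑ i, (u p.1 - u₀) (x i) ^ 2 -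
        2 * ∑ i, e i * (u p.1 - u₀) (x i) + ∑ i, e i ^ 2 := by
      rw [Finset.mul_sum, ← Finset.sum_sub_distrib, ← Finset.sum_add_distrib]
      refine Finset.sum_congr rfl fun i _ => ?_
      simp only [Pi.sub_apply]
      ring
    rw [this]
    ring
  rw [key, key] at h
  have : ∑ i, e i * (u p.1 - u q.1) (x i) =
      ∑ i, e i * (u p.1 - u₀) (x i) - ∑ i, e i * (u q.1 - u₀) (x i) := by
    rw [← Finset.sum_sub_distrib]
    refine Finset.sum_congr rfl fun i _ => ?_
    simp only [Pi.sub_apply]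
    ring
  rw [this]
  linarith

/-- From (a - b)² ≤ 2a² + 2b² the left side is at most 2τ²(p, u₀) + 2τ²(q, u₀), and the hypothesis
absorbs the second term. This moves the centre from u₀ to u_{η*}, around which the classes are
localised. -/
theorem tauSq_le_three_mul {S H T : Type*} {N : ℕ} {u : H → S → ℝ} {pen : H → T → ℝ}
    (hpen : ∀ η θ, 0 ≤ pen η θ) {x : Fin N → S} {u₀ : S → ℝ} {p q : H × T}
    (h : 2 * tauSq u pen x q u₀ ≤ tauSq u pen x p u₀) :
    tauSq u pen x p (u q.1) ≤ 3 * tauSq u pen x p u₀ := by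
  have h1 : empNormSq x (u p.1 - u q.1) ≤
      2 * empNormSq x (u p.1 - u₀) + 2 * empNormSq x (u q.1 - u₀) := by
    unfold empNormSq
    rw [mul_left_comm, mul_left_comm 2, ← mul_add]
    gcongr
    rw [Finset.mul_sum, Finset.mul_sum, ← Finset.sum_add_distrib]
    gcongr with i
    simp only [Pi.sub_apply]
    nlinarith [sq_nonneg ((u p.1 (x i) - u₀ (x i)) + (u q.1 (x i) - u₀ (x i)))]
  unfold tauSq at *
  linarith [hpen p.1 p.2, hpen q.1 q.2]

/-- Every positive scale ratio has a dyadic level: the first power of two dominating `a`. -/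
theorem exists_dyadic_level {a R : ℝ} (hR : 0 < R) :
    ∃ j : ℕ, a ≤ 2 ^ j * R ∧ (j = 0 ∨ 2 ^ j * R < 2 * a) := by
  classical
  have hex : ∃ j : ℕ, a ≤ 2 ^ j * R := by
    obtain ⟨j, hj⟩ := pow_unbounded_of_one_lt (a / R) (one_lt_two (α := ℝ))
    exact ⟨j, ((div_lt_iff₀ hR).1 hj).le⟩
  refine ⟨Nat.find hex, Nat.find_spec hex, ?_⟩
  rcases h : Nat.find hex with _ | j
  · exact Or.inl rfl
  · right
    have := Nat.find_min hex (m := j) (by omega)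
    rw [not_le] at this
    rw [pow_succ]
    linarith

/-- The exponential tail of the penalised least squares estimator for a fixed design. -/
theorem measure_tauSq_ge_le {S H T : Type*} {N : ℕ} (hN : 1 ≤ N) {u : H → S → ℝ}
    {pen : H → T → ℝ} (hpen : ∀ η θ, 0 ≤ pen η θ) {σ : ℝ} (hσ : 0 < σ)
    {ν : Measure (Fin N → ℝ)}
    (hν : ∀ (a : Fin N → ℝ) (v t : ℝ), 0 < v → 0 ≤ t → σ ^ 2 * ∑ i, a i ^ 2 ≤ v →
      ν {e | t ≤ ∑ i, a i * e i} ≤ ENNReal.ofReal (Real.exp (-(t ^ 2 / (2 * v)))))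
    (x : Fin N → S) (u₀ : S → ℝ) (est : (Fin N → ℝ) → H × T)
    (hest : ∀ y p, objective u pen x y (est y) ≤ objective u pen x y p)
    (etaStar : H) (thetaStar : T) {Ψ : ℝ → ℝ}
    (hΨ : ∀ R : ℝ, 0 < R → entropyIntegral u pen x σ etaStar R ≤ ENNReal.ofReal (Ψ R))
    (hanti : AntitoneOn (fun R : ℝ => Ψ R / R ^ 2) (Set.Ioi 0))
    {δ : ℝ} (hδ : 0 < δ) (hδΨ : 230400 * Ψ δ ≤ Real.sqrt N * δ ^ 2) {R : ℝ} (hR : δ ≤ R)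
    (hNR : 1 ≤ (N : ℝ) * R ^ 2 / (230400 * σ ^ 2)) :
    ν {e | 2 * (tauSq u pen x (etaStar, thetaStar) u₀ + R ^ 2) ≤
        tauSq u pen x (est (fun i => u₀ (x i) + e i)) u₀} ≤
      ENNReal.ofReal (230400 * Real.exp (-((N : ℝ) * R ^ 2 / (230400 * σ ^ 2)))) := by
  have hR0 : 0 < R := hδ.trans_le hR
  set M := (N : ℝ) * R ^ 2 / (230400 * σ ^ 2) with hM
  have hscale : ∀ S : ℝ, δ ≤ S → 230400 * Ψ S ≤ Real.sqrt N * S ^ 2 := by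
    intro S hS
    have hS0 : 0 < S := hδ.trans_le hS
    have h1 : Ψ S / S ^ 2 ≤ Ψ δ / δ ^ 2 := hanti hδ hS0 hS
    have h2 : Ψ δ / δ ^ 2 ≤ Real.sqrt N / 230400 := by
      rw [div_le_div_iff₀ (by positivity) (by norm_num)]
      linarith
    have h3 := h1.trans h2
    rw [div_le_div_iff₀ (by positivity) (by norm_num)] at h3
    linarith
  have hRj : ∀ j : ℕ, R ≤ 2 ^ j * R := fun j =>
    le_mul_of_one_le_left hR0.le (one_le_pow₀ (by norm_num))
  have hlevel : ∀ j : ℕ, ν {e | ∃ f ∈ localClass u pen x etaStar (2 ^ j * R),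
      (2 ^ j * R) ^ 2 / 48 ≤ 1 / (N : ℝ) * ∑ i, e i * (f - u etaStar) (x i)} ≤
      ENNReal.ofReal (Real.exp (-M)) * 2⁻¹ ^ j := by
    intro j
    refine (measure_exists_localClass_le hN hpen hσ hν x etaStar (by positivity)
      (hΨ _ (by positivity)) (hscale _ (hR.trans (hRj j)))).trans ?_
    have h2' : (2⁻¹ : ℝ≥0∞) ^ j = ENNReal.ofReal ((1 / 2) ^ j) := by
      rw [ENNReal.ofReal_pow (by norm_num), one_div, ENNReal.ofReal_inv_of_pos (by norm_num)]
      simp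
    rw [h2', ← ENNReal.ofReal_mul (Real.exp_nonneg _)]
    apply ENNReal.ofReal_le_ofReal
    have h4 : Real.exp (-1) ≤ 1 / 2 := by
      rw [Real.exp_neg, one_div]
      apply inv_anti₀ (by norm_num)
      linarith [Real.add_one_le_exp 1]
    have h5 : (N : ℝ) * (2 ^ j * R) ^ 2 / (230400 * σ ^ 2) = 4 ^ j * M := by
      rw [hM, show (4 : ℝ) = 2 ^ 2 by norm_num, ← pow_mul, mul_comm 2 j, pow_mul]
      ring
    have h6 : (1 : ℝ) + j ≤ 4 ^ j := by
      have := one_add_mul_le_pow (show (-2 : ℝ) ≤ 3 by norm_num) j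
      norm_num at this
      have hj : (0 : ℝ) ≤ j := Nat.cast_nonneg j
      linarith
    -- Here M ≥ 1 is essential: it leaves a factor e^(-j) ≤ 2^(-j), making the levels summable.
    have h7 : M + j ≤ 4 ^ j * M := by
      have hj : (0 : ℝ) ≤ j := Nat.cast_nonneg j
      nlinarith
    calc _ ≤ Real.exp (-(M + j)) := by rw [h5]; gcongr
      _ = Real.exp (-M) * Real.exp (-1) ^ j := by
        rw [← Real.exp_nat_mul, ← Real.exp_add]
        congr 1
        ring
      _ ≤ _ := by gcongr
  refine (measure_mono (t := ⋃ j : ℕ, {e | ∃ f ∈ localClass u pen x etaStar (2 ^ j * R),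
      (2 ^ j * R) ^ 2 / 48 ≤ 1 / (N : ℝ) * ∑ i, e i * (f - u etaStar) (x i)}) ?_).trans
    ((measure_iUnion_le _).trans ((ENNReal.tsum_le_tsum hlevel).trans ?_))
  · intro e he
    rw [Set.mem_ofPred_eq] at he
    set p := est (fun i => u₀ (x i) + e i) with hp
    have hbasic := tauSq_le_of_objective_le (hest (fun i => u₀ (x i) + e i) (etaStar, thetaStar))
    rw [← hp] at hbasic
    have h3 := tauSq_le_three_mul hpen (x := x) (u₀ := u₀) (p := p) (q := (etaStar, thetaStar))
      (by linarith [sq_nonneg R])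
    dsimp only at hbasic h3
    set W := tauSq u pen x p (u etaStar) with hW
    have hW0 : 0 ≤ W := tauSq_nonneg hpen _ _ _
    obtain ⟨j, hj1, hj2⟩ := exists_dyadic_level (a := Real.sqrt W) hR0
    refine Set.mem_iUnion.2 ⟨j, u p.1, ⟨p.1, p.2, rfl, ?_⟩, ?_⟩
    · exact (Real.sqrt_le_left (by positivity)).1 hj1
    -- The basic inequality and the event give τ²(p, u₀)/2 + R² ≤ 2 · noise, and W ≤ 3τ²(p, u₀). As
    -- (2^j R)² ≤ 4W + R², dividing by 48 gives at most W/12 + R²/48, below the noise average. The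
    -- R² term covers level 0, where W may be tiny.
    · have hkey : W / 6 + R ^ 2 ≤ 2 * (1 / (N : ℝ) * ∑ i, e i * (u p.1 - u etaStar) (x i)) := by
        linarith
      have h6 : (2 ^ j * R) ^ 2 ≤ 4 * W + R ^ 2 := by
        rcases hj2 with rfl | hj2
        · simp [hW0]
        · have := pow_le_pow_left₀ (by positivity) hj2.le 2
          rw [mul_pow 2 (Real.sqrt W), Real.sq_sqrt hW0] at this
          nlinarith [sq_nonneg R]
      linarith [sq_nonneg R]
  · rw [ENNReal.tsum_mul_left, ENNReal.tsum_geometric, ENNReal.one_sub_inv_two, inv_inv,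
      mul_comm, ENNReal.ofReal_mul (by norm_num)]
    gcongr
    norm_num

/-! ### Gaussian noise and conditioning on the design -/

/-- Linear forms of independent centred Gaussian variables have sub-Gaussian tails. -/
theorem map_gaussian_noise_tail {N : ℕ} {Ω : Type*} [MeasurableSpace Ω] {P : Measure Ω}
    [IsProbabilityMeasure P] {ε : Fin N → Ω → ℝ} {s : Fin N → ℝ≥0} {σ : ℝ}
    (hs : ∀ i, (s i : ℝ) ≤ σ) (hlaw : ∀ i, HasLaw (ε i) (gaussianReal 0 (s i ^ 2)) P)
    (hind : iIndepFun ε P) (a : Fin N → ℝ) (v t : ℝ) (hv : 0 < v) (ht : 0 ≤ t)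
    (hav : σ ^ 2 * ∑ i, a i ^ 2 ≤ v) :
    P.map (fun ω i => ε i ω) {e | t ≤ ∑ i, a i * e i} ≤
      ENNReal.ofReal (Real.exp (-(t ^ 2 / (2 * v)))) := by
  have hsg : ∀ i, HasSubgaussianMGF (ε i) (s i ^ 2) P := by
    intro i
    rw [← HasSubgaussianMGF.id_map_iff (hlaw i).aemeasurable, (hlaw i).map_eq]
    refine ⟨fun t => integrable_exp_mul_gaussianReal t, fun t => ?_⟩
    rw [mgf_id_gaussianReal]
    simp
  have hind' : iIndepFun (fun i ω => a i * ε i ω) P :=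
    hind.comp (fun i y => a i * y) fun i => measurable_const_mul _
  have hsum := HasSubgaussianMGF.sum_of_iIndepFun hind' (s := Finset.univ)
    fun i _ => (hsg i).const_mul (a i)
  set c : ℝ≥0 := ∑ i, NNReal.mk (a i ^ 2) (sq_nonneg (a i)) * s i ^ 2 with hc
  have hcv : (c : ℝ) ≤ v := by
    refine le_trans ?_ hav
    rw [hc, Finset.mul_sum, NNReal.coe_sum]
    refine Finset.sum_le_sum fun i _ => ?_
    rw [NNReal.coe_mul, NNReal.coe_mk, NNReal.coe_pow, mul_comm]
    gcongr
    exact hs i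
  -- The variance proxy is raised to the positive number `v`, which also handles a degenerate linear
  -- form of variance 0.
  have hsum' : HasSubgaussianMGF (fun ω => ∑ i, a i * ε i ω) ⟨v, hv.le⟩ P :=
    ⟨hsum.integrable_exp_mul, fun t => (hsum.mgf_le t).trans (by
      gcongr
      exact hcv)⟩
  have h1 := hsum'.measure_ge_le ht
  rw [Measure.map_apply_of_aemeasurable (aemeasurable_pi_lambda _ fun i => (hlaw i).aemeasurable)
    (measurableSet_le measurable_const (by fun_prop))]
  rw [Measure.real, ← ENNReal.le_ofReal_iff_toReal_le (measure_ne_top _ _) (Real.exp_nonneg _)] at h1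
  rwa [neg_div] at h1

/-- Conditioning on an independent variable: a bound on almost every section of an event bounds its
probability on each event determined by the conditioning variable. -/
theorem measure_inter_le_of_indepFun {Ω α β : Type*} [MeasurableSpace Ω] [MeasurableSpace α]
    [MeasurableSpace β] {P : Measure Ω} [IsProbabilityMeasure P] {X : Ω → α} {E : Ω → β}
    (hX : Measurable X) (hE : AEMeasurable E P) (hind : IndepFun X E P) {G : Set (α × β)}
    (hG : NullMeasurableSet G (P.map fun ω => (X ω, E ω))) {q : ℝ≥0∞}
    (hq : ∀ᵐ ω ∂P, P.map E {e | (X ω, e) ∈ G} ≤ q) {B : Set α} (hB : MeasurableSet B) :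
    P {ω | X ω ∈ B ∧ (X ω, E ω) ∈ G} ≤ q * P {ω | X ω ∈ B} := by
  have hprod : P.map (fun ω => (X ω, E ω)) = (P.map X).prod (P.map E) :=
    (indepFun_iff_map_prod_eq_prod_map_map hX.aemeasurable hE).1 hind
  have : IsProbabilityMeasure (P.map X) := Measure.isProbabilityMeasure_map hX.aemeasurable
  have : IsProbabilityMeasure (P.map E) := Measure.isProbabilityMeasure_map hE
  -- `G` is only null measurable. A measurable hull makes Fubini applicable, and almost all of its
  -- sections agree almost everywhere with those of `G`.
  obtain ⟨G', hGG', hG'm, hae⟩ := hG.exists_measurable_superset_ae_eq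
  rw [hprod] at hae
  have hsec : ∀ᵐ ω ∂P, P.map E {e | (X ω, e) ∈ G'} ≤ q := by
    have h1 : ∀ᵐ x ∂(P.map X), ∀ᵐ e ∂(P.map E), (x, e) ∈ G' ↔ (x, e) ∈ G :=
      Measure.ae_ae_of_ae_prod (hae.mono fun z hz => iff_of_eq hz)
    filter_upwards [hq, ae_of_ae_map hX.aemeasurable h1] with ω h2 h3
    refine le_trans (le_of_eq (measure_congr ?_)) h2
    filter_upwards [h3] with e he
    exact propext he
  calc P {ω | X ω ∈ B ∧ (X ω, E ω) ∈ G}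
      ≤ P.map (fun ω => (X ω, E ω)) ((B ×ˢ Set.univ) ∩ G') := by
        refine le_trans (measure_mono ?_)
          (Measure.le_map_apply (hX.aemeasurable.prodMk hE) _)
        rintro ω ⟨h1, h2⟩
        exact ⟨⟨h1, trivial⟩, hGG' h2⟩
    _ = ∫⁻ x, P.map E (Prod.mk x ⁻¹' ((B ×ˢ Set.univ) ∩ G')) ∂(P.map X) := by
        rw [hprod, Measure.prod_apply ((hB.prod MeasurableSet.univ).inter hG'm)]
    _ = ∫⁻ ω, P.map E (Prod.mk (X ω) ⁻¹' ((B ×ˢ Set.univ) ∩ G')) ∂P :=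
        lintegral_map (measurable_measure_prodMk_left
          ((hB.prod MeasurableSet.univ).inter hG'm)) hX
    _ ≤ ∫⁻ ω, (X ⁻¹' B).indicator (fun _ => q) ω ∂P := by
        refine lintegral_mono_ae ?_
        filter_upwards [hsec] with ω hω
        by_cases h : ω ∈ X ⁻¹' B
        · rw [Set.indicator_of_mem h]
          exact (measure_mono fun e he => he.2).trans hω
        · rw [Set.indicator_of_notMem h]
          refine le_of_eq (measure_mono_null (t := ∅) ?_ measure_empty)
          rintro e ⟨he, -⟩
          exact h he.1
    _ = q * P {ω | X ω ∈ B} := by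
        rw [lintegral_indicator_const (hX hB)]
        rfl

/-! ### From tails to moments -/

/-- As exp(-y) = o(y^(-(k+1))) at y = 4^j, the terms are O(4^(-j)). The sum enters the moment
constant C_k. -/
theorem summable_pow_mul_exp_neg (k c : ℝ) :
    Summable fun j : ℕ => ((4 : ℝ) ^ (j + 1)) ^ k * (c * Real.exp (-4 ^ j)) := by
  have h1 : (fun x : ℝ => Real.exp (-1 * x)) =o[Filter.atTop] fun x => x ^ (-(k + 1)) :=
    isLittleO_exp_neg_mul_rpow_atTop one_pos _
  have h2 : Filter.Tendsto (fun j : ℕ => (4 : ℝ) ^ j) Filter.atTop Filter.atTop :=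
    tendsto_pow_atTop_atTop_of_one_lt (by norm_num)
  have h3 := (h1.comp_tendsto h2).isBigO
  have h4 : Summable fun j : ℕ => (1 / 4 : ℝ) ^ j :=
    summable_geometric_of_lt_one (by norm_num) (by norm_num)
  refine summable_of_isBigO_nat h4 ?_
  have h5 := (((Asymptotics.isBigO_refl (fun j : ℕ => ((4 : ℝ) ^ (j + 1)) ^ k) Filter.atTop).mul
    h3).const_mul_left c).trans (Asymptotics.isBigO_of_le' (c := 4 ^ k)
      (g := fun j : ℕ => (1 / 4 : ℝ) ^ j) Filter.atTop fun j => le_of_eq ?_)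
  · refine h5.congr_left fun j => ?_
    simp only [Function.comp, neg_one_mul]
    ring
  · have h40 : (0 : ℝ) < 4 ^ j := by positivity
    rw [Real.norm_of_nonneg (by simp only [Function.comp]; positivity),
      Real.norm_of_nonneg (by positivity), pow_succ, Real.mul_rpow h40.le (by norm_num)]
    simp only [Function.comp]
    rw [Real.rpow_neg h40.le, Real.rpow_add h40, Real.rpow_one, one_div, inv_pow]
    have : (0 : ℝ) < (4 ^ j) ^ k := by positivity
    field_simp

theorem rpow_le_of_le_two_mul_add {v a b k : ℝ} (hv : 0 ≤ v) (ha : 0 ≤ a) (hb : 0 ≤ b)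
    (hk : 0 ≤ k) (h : v ≤ 2 * (a + b)) : v ^ k ≤ 4 ^ k * (a ^ k + b ^ k) := by
  have h1 : v ≤ 4 * max a b := by linarith [le_max_left a b, le_max_right a b]
  refine (Real.rpow_le_rpow hv h1 hk).trans ?_
  rw [Real.mul_rpow (by norm_num) (le_max_of_le_left ha)]
  gcongr
  have h2 := Real.rpow_nonneg ha k
  have h3 := Real.rpow_nonneg hb k
  rcases max_cases a b with ⟨h, -⟩ | ⟨h, -⟩ <;> rw [h] <;> linarith

/-- Moment bounds from exponential tails at the dyadic levels `2 ^ j * δ`. -/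
theorem lintegral_rpow_le_of_tail {Ω : Type*} [MeasurableSpace Ω] {Q : Measure Ω}
    {V τ : Ω → ℝ} (hV : AEMeasurable V Q) (hτ : AEMeasurable τ Q) (hV0 : ∀ ω, 0 ≤ V ω)
    (hτ0 : ∀ ω, 0 ≤ τ ω) {δ c k : ℝ} (hδ : 0 < δ) (hc : 0 ≤ c) (hk : 0 ≤ k)
    (htail : ∀ j : ℕ, Q {ω | 2 * (τ ω + (2 ^ j * δ) ^ 2) ≤ V ω} ≤
      ENNReal.ofReal (c * Real.exp (-4 ^ j)) * Q Set.univ) :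
    ∫⁻ ω, ENNReal.ofReal (V ω ^ k) ∂Q ≤ ∫⁻ ω, ENNReal.ofReal (4 ^ k *
      (1 + ∑' j : ℕ, ((4 : ℝ) ^ (j + 1)) ^ k * (c * Real.exp (-4 ^ j))) *
        (τ ω ^ k + δ ^ (2 * k))) ∂Q := by
  classical
  set a : ℕ → ℝ := fun j => ((4 : ℝ) ^ (j + 1)) ^ k * (c * Real.exp (-4 ^ j)) with ha
  have ha0 : ∀ j, 0 ≤ a j := fun j => by positivity
  have hδk : δ ^ (2 * k) = (δ ^ 2) ^ k := by
    rw [Real.rpow_mul hδ.le]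
    norm_num
  set E : ℕ → Set Ω := fun j => {ω | 2 * (τ ω + (2 ^ j * δ) ^ 2) ≤ V ω} with hE
  have hEm : ∀ j, NullMeasurableSet (E j) Q := fun j =>
    nullMeasurableSet_le ((hτ.add_const _).const_mul 2) hV
  set f : Ω → ℝ≥0∞ := fun ω => ENNReal.ofReal (4 ^ k * (τ ω ^ k + δ ^ (2 * k))) with hf
  have hfm : AEMeasurable f Q := by
    refine AEMeasurable.ennreal_ofReal (((hτ.pow_const k).add_const _).const_mul _)
  -- Take the least j with V < 2(τ + (2^j δ)²). If it is 0, `f` suffices. If it is j + 1, the point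
  -- lies in `E j`, which is why the weight 4^(j+1) goes with the tail at level j.
  have hpt : ∀ ω, ENNReal.ofReal (V ω ^ k) ≤ f ω +
      ∑' j, (E j).indicator (fun _ => ENNReal.ofReal
        (4 ^ k * (((4 : ℝ) ^ (j + 1)) ^ k * δ ^ (2 * k)))) ω := by
    intro ω
    have hsq : ∀ j : ℕ, ((2 : ℝ) ^ j * δ) ^ 2 = 4 ^ j * δ ^ 2 := by
      intro j
      rw [mul_pow, ← pow_mul, mul_comm j 2, pow_mul]
      norm_num
    have hex : ∃ j : ℕ, V ω < 2 * (τ ω + (2 ^ j * δ) ^ 2) := by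
      obtain ⟨j, hj⟩ := pow_unbounded_of_one_lt (V ω / δ ^ 2) (show (1 : ℝ) < 4 by norm_num)
      refine ⟨j, ?_⟩
      rw [div_lt_iff₀ (by positivity)] at hj
      rw [hsq]
      nlinarith [hV0 ω, hτ0 ω]
    have hspec := Nat.find_spec hex
    rcases hj : Nat.find hex with _ | j
    · rw [hj] at hspec
      refine le_add_right (ENNReal.ofReal_le_ofReal ?_)
      rw [hδk]
      refine rpow_le_of_le_two_mul_add (hV0 ω) (hτ0 ω) (by positivity) hk ?_
      simpa using hspec.le
    · rw [hj, hsq] at hspec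
      have hmem : ω ∈ E j := not_lt.1 (Nat.find_min hex (m := j) (by omega))
      refine le_trans ?_ (add_le_add_right (ENNReal.le_tsum j) _)
      rw [Set.indicator_of_mem hmem, hf, ← ENNReal.ofReal_add (by have := hτ0 ω; positivity)
        (by positivity)]
      apply ENNReal.ofReal_le_ofReal
      refine (rpow_le_of_le_two_mul_add (hV0 ω) (hτ0 ω) (by positivity) hk hspec.le).trans ?_
      rw [Real.mul_rpow (by positivity) (by positivity), ← hδk]
      have : 0 ≤ (4 : ℝ) ^ k * δ ^ (2 * k) := by positivity
      linarith
  have hterm : ∀ j, ∫⁻ ω, (E j).indicator (fun _ => ENNReal.ofReal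
        (4 ^ k * (((4 : ℝ) ^ (j + 1)) ^ k * δ ^ (2 * k)))) ω ∂Q ≤
      ENNReal.ofReal (4 ^ k * δ ^ (2 * k) * a j) * Q Set.univ := by
    intro j
    rw [lintegral_indicator_const₀ (hEm j)]
    refine (mul_le_mul_right (htail j) _).trans (le_of_eq ?_)
    rw [← mul_assoc, ← ENNReal.ofReal_mul (by positivity)]
    congr 2
    simp only [ha]
    ring
  calc ∫⁻ ω, ENNReal.ofReal (V ω ^ k) ∂Q
      ≤ ∫⁻ ω, f ω ∂Q + ∑' j, ∫⁻ ω, (E j).indicator (fun _ => ENNReal.ofReal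
        (4 ^ k * (((4 : ℝ) ^ (j + 1)) ^ k * δ ^ (2 * k)))) ω ∂Q := by
        rw [← lintegral_tsum fun j => aemeasurable_const.indicator₀ (hEm j),
          ← lintegral_add_left' hfm]
        exact lintegral_mono hpt
    _ ≤ ∫⁻ ω, f ω ∂Q + ∑' j, ENNReal.ofReal (4 ^ k * δ ^ (2 * k) * a j) * Q Set.univ := by
        gcongr with j
        exact hterm j
    _ = ∫⁻ ω, (f ω + ENNReal.ofReal (4 ^ k * δ ^ (2 * k) * ∑' j, a j)) ∂Q := by
        rw [ENNReal.tsum_mul_right, ← ENNReal.ofReal_tsum_of_nonneg (fun j => by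
          have := ha0 j; positivity) ((summable_pow_mul_exp_neg k c).mul_left _), tsum_mul_left,
          lintegral_add_right _ measurable_const, lintegral_const]
    _ ≤ _ := by
        refine lintegral_mono fun ω => ?_
        have h1 : 0 ≤ ∑' j, a j := tsum_nonneg ha0
        have h2 : 0 ≤ τ ω ^ k := Real.rpow_nonneg (hτ0 ω) k
        rw [hf, ← ENNReal.ofReal_add (by positivity) (by positivity)]
        apply ENNReal.ofReal_le_ofReal
        have : 0 ≤ (4 : ℝ) ^ k * (∑' j, a j) * τ ω ^ k := by positivity
        linarith

/-! ### Measurability and assembly -/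

theorem aemeasurable_tauSq {S H T Ω : Type*} [MeasurableSpace S] [MeasurableSpace Ω] {N : ℕ}
    {u : H → S → ℝ} {pen : H → T → ℝ} {μ : Measure Ω} {x : Fin N → Ω → S}
    (hx : ∀ i, Measurable (x i)) {u₀ : S → ℝ} (hu₀ : ∀ i, AEMeasurable u₀ (μ.map (x i))) {p : H × T}
    (hp : ∀ i, AEMeasurable (u p.1) (μ.map (x i))) :
    AEMeasurable (fun ω => tauSq u pen (fun i => x i ω) p u₀) μ := by
  unfold tauSq empNormSq
  refine AEMeasurable.add_const (AEMeasurable.const_mul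
    (Finset.aemeasurable_fun_sum _ fun i _ => ?_) _) _
  exact (((hp i).comp_measurable (hx i)).sub ((hu₀ i).comp_measurable (hx i))).pow_const 2

/-- A design satisfying the entropy condition has `N δ² ≥ C σ²`. -/
theorem one_le_of_entropyIntegral_le {S H T : Type*} {N : ℕ} {u : H → S → ℝ} {pen : H → T → ℝ}
    {x : Fin N → S} {etaStar : H} {σ δ R I : ℝ} (hσ : 0 < σ) (hδ : 0 < δ)
    (hI : entropyIntegral u pen x σ etaStar δ ≤ ENNReal.ofReal I)
    (hIδ : 230400 * I ≤ Real.sqrt N * δ ^ 2) (hR : δ ≤ R) :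
    1 ≤ (N : ℝ) * R ^ 2 / (230400 * σ ^ 2) := by
  have h1 : σ * δ ≤ I := by
    have h2 : ENNReal.ofReal (σ * δ) ≤ ENNReal.ofReal I := le_trans le_self_add hI
    have h3 : 0 < σ * δ := by positivity
    by_contra! hlt
    exact not_le.2 ((ENNReal.ofReal_lt_ofReal_iff h3).2 hlt) h2
  have h2 : 230400 * σ ≤ Real.sqrt N * δ := by
    refine le_of_mul_le_mul_right ?_ hδ
    nlinarith
  have h3 := pow_le_pow_left₀ (by positivity) h2 2
  rw [mul_pow, mul_pow, Real.sq_sqrt (Nat.cast_nonneg N)] at h3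
  have h4 : (N : ℝ) * δ ^ 2 ≤ N * R ^ 2 := by gcongr
  rw [one_le_div (by positivity)]
  nlinarith [sq_nonneg σ]

theorem mainTheorem7 :
    -- `C` is universal and `Cm k` depends on `k` only
    ∃ C : ℝ, 0 < C ∧ ∃ Cm : ℝ → ℝ, (∀ k : ℝ, 1 ≤ k → 0 < Cm k) ∧
    ∀ (d : ℕ) (_ : 1 ≤ d)
      (O : Set (EuclideanSpace ℝ (Fin d))) (_ : MeasurableSet O) (_ : O.Nonempty)
      (N : ℕ) (_ : 1 ≤ N)
      (Ω : Type*) [MeasurableSpace Ω] (P : Measure Ω) [IsProbabilityMeasure P]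
      -- the design points (random or deterministic), the noise, the noise levels
      (X : Fin N → Ω → O) (_ : ∀ i, Measurable (X i))
      (ε : Fin N → Ω → ℝ) (s : Fin N → ℝ≥0) (σ : ℝ) (_ : 0 < σ) (_ : ∀ i, (s i : ℝ) ≤ σ)
      (_ : ∀ i, HasLaw (ε i) (gaussianReal 0 (s i ^ 2)) P)
      (_ : iIndepFun ε P)
      (_ : IndepFun (fun ω i => X i ω) (fun ω i => ε i ω) P)
      -- the regression function and the observations `Y i = u₀ (X i) + ε i`
      (u₀ : O → ℝ) (_ : ∀ i, AEMeasurable u₀ (P.map (X i)))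
      (Y : Fin N → Ω → ℝ) (_ : ∀ i ω, Y i ω = u₀ (X i ω) + ε i ω)
      -- the parameter sets, the parametrisation and the penalty
      (H : Type*) (T : Type*) (u : H → O → ℝ)
      (pen : H → T → ℝ) (_ : ∀ η θ, 0 ≤ pen η θ)
      -- the estimator: a function of the data which minimises the objective and whose
      -- discrepancy from `u₀` is a measurable function of the data
      (est : (Fin N → O) → (Fin N → ℝ) → H × T)
      (_ : ∀ᵐ ω ∂P, ∀ (y : Fin N → ℝ) (p : H × T),
        objective u pen (fun i => X i ω) y (est (fun i => X i ω) y) ≤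
          objective u pen (fun i => X i ω) y p)
      (_ : AEMeasurable
        (fun z : (Fin N → O) × (Fin N → ℝ) => tauSq u pen z.1 (est z.1 z.2) u₀)
        (P.map (fun ω => ((fun i => X i ω), (fun i => Y i ω)))))
      -- the centring, and the upper bound on the entropy integral
      (etaStar : H) (thetaStar : T) (_ : ∀ i, AEMeasurable (u etaStar) (P.map (X i)))
      (Ψ : ℝ → ℝ)
      (_ : ∀ᵐ ω ∂P, ∀ R : ℝ, 0 < R →
        entropyIntegral u pen (fun i => X i ω) σ etaStar R ≤ ENNReal.ofReal (Ψ R))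
      (_ : AntitoneOn (fun R : ℝ => Ψ R / R ^ 2) (Set.Ioi 0))
      (δ : ℝ) (_ : 0 < δ) (_ : C * Ψ δ ≤ Real.sqrt N * δ ^ 2)
      -- both bounds hold on every event determined by the design, that is, conditionally on the
      -- design; `B = Set.univ` is the unconditional case
      (B : Set (Fin N → O)) (_ : MeasurableSet B),
      (∀ R : ℝ, δ ≤ R →
        P {ω | (fun i => X i ω) ∈ B ∧
            2 * (tauSq u pen (fun i => X i ω) (etaStar, thetaStar) u₀ + R ^ 2) ≤
              tauSq u pen (fun i => X i ω) (est (fun i => X i ω) (fun i => Y i ω)) u₀} ≤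
          ENNReal.ofReal (C * Real.exp (-((N : ℝ) * R ^ 2 / (C * σ ^ 2)))) *
            P {ω | (fun i => X i ω) ∈ B}) ∧
      (∀ k : ℝ, 1 ≤ k →
        ∫⁻ ω in {ω | (fun i => X i ω) ∈ B},
            ENNReal.ofReal
              (tauSq u pen (fun i => X i ω) (est (fun i => X i ω) (fun i => Y i ω)) u₀ ^ k) ∂P ≤
          ∫⁻ ω in {ω | (fun i => X i ω) ∈ B},
            ENNReal.ofReal (Cm k *
              (tauSq u pen (fun i => X i ω) (etaStar, thetaStar) u₀ ^ k + δ ^ (2 * k) +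
                δ ^ (2 * k - 2) * σ ^ 2 / N)) ∂P) := by
  refine ⟨230400, by norm_num, fun k => 4 ^ k *
      (1 + ∑' j : ℕ, ((4 : ℝ) ^ (j + 1)) ^ k * (230400 * Real.exp (-4 ^ j))), ?_, ?_⟩
  · intro k _
    have : 0 ≤ ∑' j : ℕ, ((4 : ℝ) ^ (j + 1)) ^ k * (230400 * Real.exp (-4 ^ j)) :=
      tsum_nonneg fun j => by positivity
    positivity
  intro d _ O _ _ N hN Ω _ P _ X hX ε s σ hσ hs hlaw hind hXε u₀ hu₀ Y hY H T u pen hpen est hest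
    hVm etaStar thetaStar hu' Ψ hΨ hanti δ hδ hδΨ B hB
  obtain rfl : Y = fun i ω => u₀ (X i ω) + ε i ω := funext fun i => funext fun ω => hY i ω
  have hXm : Measurable (fun ω i => X i ω) := measurable_pi_lambda _ hX
  have hεm : AEMeasurable (fun ω i => ε i ω) P :=
    aemeasurable_pi_lambda _ fun i => (hlaw i).aemeasurable
  have hpair : AEMeasurable (fun ω => ((fun i => X i ω), (fun i => ε i ω))) P :=
    hXm.aemeasurable.prodMk hεm
  have hτP : AEMeasurable (fun ω => tauSq u pen (fun i => X i ω) (etaStar, thetaStar) u₀) P :=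
    aemeasurable_tauSq hX hu₀ hu'
  have hYm : ∀ i, AEMeasurable (fun ω => u₀ (X i ω) + ε i ω) P := fun i =>
    ((hu₀ i).comp_measurable (hX i)).add (hlaw i).aemeasurable
  have hVP : AEMeasurable (fun ω => tauSq u pen (fun i => X i ω)
      (est (fun i => X i ω) (fun i => u₀ (X i ω) + ε i ω)) u₀) P :=
    hVm.comp_aemeasurable (hXm.aemeasurable.prodMk (aemeasurable_pi_lambda _ hYm))
  set π := P.map (fun ω => ((fun i => X i ω), (fun i => ε i ω))) with hπ
  have hπX : ∀ i, π.map (fun z : (Fin N → O) × (Fin N → ℝ) => z.1 i) = P.map (X i) := fun i =>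
    AEMeasurable.map_map_of_aemeasurable (by fun_prop) hpair
  have hτπ : AEMeasurable (fun z : (Fin N → O) × (Fin N → ℝ) =>
      tauSq u pen z.1 (etaStar, thetaStar) u₀) π := by
    refine aemeasurable_tauSq (x := fun i (z : (Fin N → O) × (Fin N → ℝ)) => z.1 i)
      (fun i => by fun_prop) (fun i => ?_) (fun i => ?_)
    · rw [hπX]; exact hu₀ i
    · rw [hπX]; exact hu' i
  -- Measurability is assumed under the law of (X, Y), whereas independence concerns (X, ε). The map
  -- (x, e) ↦ (x, u₀(x) + e) transfers it.
  have hΦ : AEMeasurable (fun z : (Fin N → O) × (Fin N → ℝ) =>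
      (z.1, fun i => u₀ (z.1 i) + z.2 i)) π := by
    refine measurable_fst.aemeasurable.prodMk (aemeasurable_pi_lambda _ fun i => ?_)
    refine AEMeasurable.add ?_ (by fun_prop)
    exact AEMeasurable.comp_measurable (f := fun z : (Fin N → O) × (Fin N → ℝ) => z.1 i)
      (by rw [hπX]; exact hu₀ i) (by fun_prop)
  have hπΦ : π.map (fun z => (z.1, fun i => u₀ (z.1 i) + z.2 i)) =
      P.map (fun ω => ((fun i => X i ω), (fun i => u₀ (X i ω) + ε i ω))) :=
    AEMeasurable.map_map_of_aemeasurable hΦ hpair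
  have hVπ : AEMeasurable (fun z : (Fin N → O) × (Fin N → ℝ) =>
      tauSq u pen z.1 (est z.1 (fun i => u₀ (z.1 i) + z.2 i)) u₀) π := by
    rw [← hπΦ] at hVm
    exact hVm.comp_aemeasurable hΦ
  have hgood : ∀ R : ℝ, δ ≤ R → 1 ≤ (N : ℝ) * R ^ 2 / (230400 * σ ^ 2) := by
    intro R hR
    -- The claim does not involve the design, so a single good ω proves it.
    obtain ⟨ω, hω⟩ := hΨ.exists
    exact one_le_of_entropyIntegral_le hσ hδ (hω δ hδ) hδΨ hR
  have htail : ∀ R : ℝ, δ ≤ R →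
      P {ω | (fun i => X i ω) ∈ B ∧
          2 * (tauSq u pen (fun i => X i ω) (etaStar, thetaStar) u₀ + R ^ 2) ≤
            tauSq u pen (fun i => X i ω)
              (est (fun i => X i ω) (fun i => u₀ (X i ω) + ε i ω)) u₀} ≤
        ENNReal.ofReal (230400 * Real.exp (-((N : ℝ) * R ^ 2 / (230400 * σ ^ 2)))) *
          P {ω | (fun i => X i ω) ∈ B} := by
    intro R hR
    refine measure_inter_le_of_indepFun hXm hεm hXε
      (nullMeasurableSet_le ((hτπ.add_const _).const_mul 2) hVπ) ?_ hB
    filter_upwards [hest, hΨ] with ω hω hΨω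
    exact measure_tauSq_ge_le hN hpen hσ (map_gaussian_noise_tail hs hlaw hind) _ u₀ _ hω etaStar
      thetaStar hΨω hanti hδ hδΨ hR (hgood R hR)
  refine ⟨htail, fun k hk => ?_⟩
  have hBm : MeasurableSet {ω | (fun i => X i ω) ∈ B} := hXm hB
  refine (lintegral_rpow_le_of_tail (c := 230400) (δ := δ) hVP.restrict hτP.restrict
    (fun ω => tauSq_nonneg hpen _ _ _) (fun ω => tauSq_nonneg hpen _ _ _) hδ (by norm_num)
    (zero_le_one.trans hk) fun j => ?_).trans (lintegral_mono fun ω => ?_)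
  · have hδj : δ ≤ 2 ^ j * δ := le_mul_of_one_le_left hδ.le (one_le_pow₀ (by norm_num))
    rw [Measure.restrict_apply' hBm, Measure.restrict_apply_univ, Set.inter_comm]
    refine (htail _ hδj).trans ?_
    gcongr
    have h1 : (N : ℝ) * (2 ^ j * δ) ^ 2 / (230400 * σ ^ 2) =
        4 ^ j * ((N : ℝ) * δ ^ 2 / (230400 * σ ^ 2)) := by
      rw [mul_pow, ← pow_mul, mul_comm j 2, pow_mul]
      norm_num
      ring
    rw [h1]
    exact le_mul_of_one_le_right (by positivity) (hgood δ le_rfl)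
  · apply ENNReal.ofReal_le_ofReal
    have h1 : 0 ≤ ∑' j : ℕ, ((4 : ℝ) ^ (j + 1)) ^ k * (230400 * Real.exp (-4 ^ j)) :=
      tsum_nonneg fun j => by positivity
    -- The term δ^(2k-2) σ²/N is added only by nonnegativity. Since N δ² ≥ 230400 σ², it is
    -- dominated by δ^(2k) anyway.
    exact mul_le_mul_of_nonneg_left (le_add_of_nonneg_right (by positivity)) (by positivity)
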